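/- For $\alpha>0$ let $S(\alpha)=\{(x,y)\in\mathbb R^2 : x,y\ge 0,\ y\le \alpha x\}$ and $I(\alpha)=S(\alpha)\cap\mathbb Z^2$. A polynomial $p\in\mathbb R[x,y]$ is a *quadratic packing polynomial* on $S(\alpha)$ if it has total degree $2$ and restricts to a bijection from $I(\alpha)$ onto $\mathbb N=\{0,1,2,\dots\}$. Let $n,m\ge 1$ be relatively prime integers and $l=\gcd(n,m-1)$ (so $l=n$ if $m=1$). For $c\in\mathbb N$, the *$c$-th staircase* of $I(n/m)$ is the set of $(x,y)\in S(n/m)$ with $(m-1)y=nx-cl$, and a *stair* is a point with integer coordinates on a staircase. Two distinct stairs $r,s$ are *consecutive* if they lie on the same staircase and no other stair lies on the line segment from $r$ to $s$. For $k\in\mathbb N$, a polynomial $p\in\mathbb R[x,y]$ of total degree $2$ is a *$k$-stair polynomial* on $S(n/m)$ if its homogeneous quadratic part is $\frac n2\left(x-\frac{m-1}{n}y\right)^2$, if $p(\mathbb Z^2)\subseteq\mathbb Z$, and if $p(r)-p(s)=\pm k$ for any two consecutive stairs $r,s$. **Theorem.** Let $n,m\ge 1$ be relatively prime integers and let $k\ge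 4$ be an integer. Then no quadratic packing polynomial on $S(n/m)$ is a $k$-stair polynomial on $S(n/m)$. -/

import Mathlib

/-- The sector `S(α)`: all `(x, y)` in the plane with `x, y ≥ 0` and `y ≤ α x`. -/
def sector (α : ℝ) : Set (ℝ × ℝ) :=
  {z | 0 ≤ z.1 ∧ 0 ≤ z.2 ∧ z.2 ≤ α * z.1}

/-- An integer point of the plane, seen as a real point. -/
def toPlane (z : ℤ × ℤ) : ℝ × ℝ := ((z.1 : ℝ), (z.2 : ℝ))

/-- `I(α)`: the lattice points of the sector `S(α)`. -/
def sectorLattice (α : ℝ) : Set (ℤ × ℤ) :=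
  {z | toPlane z ∈ sector α}

/-- The value `p(x, y)` of a real polynomial in two variables. -/
noncomputable def evalAt (p : MvPolynomial (Fin 2) ℝ) (z : ℝ × ℝ) : ℝ :=
  MvPolynomial.eval ![z.1, z.2] p

/-- `p` is a packing polynomial on `S(α)`: it maps the lattice points of `S(α)` bijectively onto
`{0, 1, 2, …}`. -/
def IsPackingPolynomial (α : ℝ) (p : MvPolynomial (Fin 2) ℝ) : Prop :=
  Set.BijOn (fun z : ℤ × ℤ => evalAt p (toPlane z)) (sectorLattice α)
    (Set.range (Nat.cast : ℕ → ℝ))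

/-- A quadratic packing polynomial on `S(α)`. -/
def IsQuadraticPackingPolynomial (α : ℝ) (p : MvPolynomial (Fin 2) ℝ) : Prop :=
  p.totalDegree = 2 ∧ IsPackingPolynomial α p

/-- `l = gcd(n, m - 1)`. -/
def stairGcd (n m : ℕ) : ℕ := Int.gcd (n : ℤ) ((m : ℤ) - 1)

/-- The `c`-th staircase of `I(n/m)`: the part in `S(n/m)` of the line
`y = (n / (m - 1)) x - c l / (m - 1)`. The equation is written without denominators, so that for
`m = 1` (where `l = n`) the staircases are the vertical segments `x = c`. -/
def staircase (n m c : ℕ) : Set (ℝ × ℝ) :=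
  {z | z ∈ sector ((n : ℝ) / (m : ℝ)) ∧
    ((m : ℝ) - 1) * z.2 = (n : ℝ) * z.1 - (c : ℝ) * (stairGcd n m : ℝ)}

/-- The stairs on the `c`-th staircase: its points with integer coordinates. -/
def stairs (n m c : ℕ) : Set (ℤ × ℤ) :=
  {z | toPlane z ∈ staircase n m c}

/-- `r` and `s` are two consecutive stairs: two different stairs on a common staircase with no
other stair on the line segment from `r` to `s`. -/
def ConsecutiveStairs (n m : ℕ) (r s : ℤ × ℤ) : Prop :=
  r ≠ s ∧ ∃ c : ℕ, r ∈ stairs n m c ∧ s ∈ stairs n m c ∧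
    ∀ t ∈ stairs n m c, toPlane t ∈ segment ℝ (toPlane r) (toPlane s) → t = r ∨ t = s

/-- `p` is a `k`-stair polynomial on `S(n/m)`. -/
structure IsKStairPolynomial (n m k : ℕ) (p : MvPolynomial (Fin 2) ℝ) : Prop where
  /-- `p` is quadratic. -/
  quadratic : p.totalDegree = 2
  /-- The homogeneous quadratic part of `p` is `(n / 2) (x - ((m - 1) / n) y) ^ 2`. -/
  quadratic_part : MvPolynomial.homogeneousComponent 2 p =
    MvPolynomial.C ((n : ℝ) / 2) *
      (MvPolynomial.X 0 - MvPolynomial.C (((m : ℝ) - 1) / (n : ℝ)) * MvPolynomial.X 1) ^ 2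
  /-- `p` is integer-valued at the integer points of the plane. -/
  integral : ∀ z : ℤ × ℤ, ∃ v : ℤ, evalAt p (toPlane z) = (v : ℝ)
  /-- The values of `p` at two consecutive stairs differ by `± k`. -/
  step : ∀ r s : ℤ × ℤ, ConsecutiveStairs n m r s →
    evalAt p (toPlane r) - evalAt p (toPlane s) = (k : ℝ) ∨
      evalAt p (toPlane r) - evalAt p (toPlane s) = -(k : ℝ)

/-! Let (a, b) be the primitive step along a staircase, completed by (u, v) to a basis of ℤ². At
c(u, v) + t(a, b), a point of staircase (row) c, the polynomial is q(c) + δt with δ = ±k and q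
quadratic of leading coefficient d/2, where l = db. Up to reflection δ = k. The value k beyond the
last one of row c must start another row, and growth forces row c + k (`row_start_add`). So rows
less than k apart are incongruent mod k (`not_dvd_sub_add`), which excludes d ≤ 2 (`three_le`). The
apex value is below k (`const_lt`). Nonnegativity at the start of row 2 then gives d(k − 2) ≤ 2k, so
k ≤ 6, and these cases fall to parity or to a congruence mod 5. -/

/-! ### Succession of rows -/

/-- A large `c` determines the solution `c'` of this perturbed quadratic equation. -/
theorem eq_add_of_quadratic_step {B E M k c c' R : ℤ} (hB : 0 < B) (hk : 0 < k)
    (hR : |R| ≤ M) (hc : M + (k + 1) * |E| + B * k ^ 2 < c) (hc' : 0 ≤ c')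
    (h : B * (c' ^ 2 - c ^ 2) + E * (c' - c) = 2 * k * B * c + R) : c' = c + k := by
  obtain ⟨hR1, hR2⟩ := abs_le.mp hR
  have hM : 0 ≤ M := (abs_nonneg R).trans hR
  have hE1 := neg_abs_le E
  have hE2 := le_abs_self E
  have hE0 := abs_nonneg E
  set A := |E|
  have hkA : 0 ≤ k * A := by positivity
  have hBk : 0 ≤ B * k ^ 2 := by positivity
  have hc0 : 0 < c := by nlinarith
  have hBc : c ≤ B * c := by nlinarith
  obtain ⟨g, rfl⟩ : ∃ g, c' = c + g := ⟨c' - c, by ring⟩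
  have h' : g * (B * (2 * c + g) + E) = 2 * k * B * c + R := by rw [← h]; ring
  have hpos : 0 < B * (2 * c + g) + E := by nlinarith
  have hkc : c ≤ k * (B * c) := by nlinarith
  -- The terms linear in `c` in `h'` match only for `g = k`; being off by one costs about `2 * B *
  -- c`, more than the other terms can absorb.
  rcases lt_trichotomy g k with hlt | heq | hgt
  · exfalso
    rcases le_or_gt g 0 with hg | hg
    · have : g * (B * (2 * c + g) + E) ≤ 0 := mul_nonpos_of_nonpos_of_nonneg hg hpos.le
      nlinarith
    · have h1 : g * (B * (2 * c + g) + E) ≤ (k - 1) * (B * (2 * c + g) + E) :=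
        mul_le_mul_of_nonneg_right (by omega) hpos.le
      have h2 : (k - 1) * (B * (2 * c + g) + E) ≤ (k - 1) * (B * (2 * c + k) + A) := by
        apply mul_le_mul_of_nonneg_left _ (by omega)
        nlinarith
      nlinarith
  · rw [heq]
  · exfalso
    have h1 : (k + 1) * (B * (2 * c + g) + E) ≤ g * (B * (2 * c + g) + E) :=
      mul_le_mul_of_nonneg_right (by omega) hpos.le
    have h2 : (k + 1) * (2 * (B * c) - A) ≤ (k + 1) * (B * (2 * c + g) + E) := by
      apply mul_le_mul_of_nonneg_left _ (by omega)
      nlinarith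
    nlinarith

/-- A bijection from the lattice points of a cone onto the nonnegative integers, quadratic in the
number `c` of the row and affine with step `k` along each row. -/
structure RowPacking (b d v k e γ : ℤ) (q : ℤ → ℤ) : Prop where
  b_pos : 0 < b
  d_pos : 0 < d
  k_ge : 4 ≤ k
  two_mul_q : ∀ c, 2 * q c = d * c ^ 2 + e * c + 2 * γ
  nonneg : ∀ c t, 0 ≤ c * v + t * b → c * v + t * b ≤ c * d * b → 0 ≤ q c + k * t
  inj : ∀ c t c' t', 0 ≤ c * v + t * b → c * v + t * b ≤ c * d * b →
    0 ≤ c' * v + t' * b → c' * v + t' * b ≤ c' * d * b →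
    q c + k * t = q c' + k * t' → c = c' ∧ t = t'
  surj : ∀ z, 0 ≤ z → ∃ c t, 0 ≤ c * v + t * b ∧ c * v + t * b ≤ c * d * b ∧ q c + k * t = z

namespace RowPacking

variable {b d v k e γ : ℤ} {q : ℤ → ℤ}

/-- The right side is the last value of row `c` plus `k`. If the point taking it had a predecessor
in its row, injectivity would make that predecessor the last point of row `c`. -/
theorem exists_row_start_eq (h : RowPacking b d v k e γ q) {c : ℤ} (hc : 0 < c) :
    ∃ c', 0 ≤ c' ∧ q c' - k * (c' * v / b) = q c + k * (c * d + -(c * v) / b + 1) := by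
  obtain ⟨hb, hd, hk, -, hnn, hinj, hsurj⟩ := h
  have h1 := Int.mul_ediv_add_emod (-(c * v)) b
  have h2 := Int.emod_nonneg (-(c * v)) hb.ne'
  have h3 := Int.emod_lt_of_pos (-(c * v)) hb
  have hcd : b ≤ c * d * b := by nlinarith [mul_pos hc hd]
  set T := -(c * v) / b
  have hD1 : 0 ≤ c * v + (c * d + T) * b := by nlinarith
  have hD2 : c * v + (c * d + T) * b ≤ c * d * b := by nlinarith
  obtain ⟨c', t', hc1, hc2, hc3⟩ := hsurj (q c + k * (c * d + T + 1))
    (by have := hnn _ _ hD1 hD2; linarith)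
  have hc'0 : 0 ≤ c' := by
    have : 0 ≤ c' * (d * b) := by nlinarith
    exact nonneg_of_mul_nonneg_left this (by positivity)
  refine ⟨c', hc'0, ?_⟩
  rcases lt_or_ge (c' * v + (t' - 1) * b) 0 with hlt | hge
  · have : t' = -(c' * v / b) := by
      have h4 := Int.mul_ediv_add_emod (c' * v) b
      have h5 := Int.emod_nonneg (c' * v) hb.ne'
      have h6 := Int.emod_lt_of_pos (c' * v) hb
      have h7 : 0 < b * (c' * v / b + t' + 1) := by nlinarith
      have h8 : b * (c' * v / b + t' - 1) < 0 := by nlinarith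
      have h9 := pos_of_mul_pos_right h7 hb.le
      have h10 := neg_of_mul_neg_right h8 hb.le
      omega
    rw [← hc3, this]; ring
  · exfalso
    obtain ⟨rfl, h5⟩ := hinj c' (t' - 1) c (c * d + T) hge (by nlinarith) hD1 hD2 (by linarith)
    obtain rfl : t' = c' * d + T + 1 := by omega
    nlinarith

theorem row_start_add_of_large (h : RowPacking b d v k e γ q) {c : ℤ}
    (hc : 2 * k * b + (k + 1) * |b * e - 2 * k * v| + b * d * k ^ 2 < c) :
    q (c + k) - k * ((c + k) * v / b) = q c + k * (c * d + -(c * v) / b + 1) := by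
  have hb := h.b_pos
  have hd := h.d_pos
  have hk := h.k_ge
  have hc0 : 0 < c := by
    have : 0 ≤ 2 * k * b + (k + 1) * |b * e - 2 * k * v| + b * d * k ^ 2 := by positivity
    omega
  obtain ⟨c', hc', heq⟩ := h.exists_row_start_eq hc0
  have h1 := Int.mul_ediv_add_emod (-(c * v)) b
  have h2 := Int.emod_nonneg (-(c * v)) hb.ne'
  have h3 := Int.emod_lt_of_pos (-(c * v)) hb
  have h4 := Int.mul_ediv_add_emod (c' * v) b
  have h5 := Int.emod_nonneg (c' * v) hb.ne'
  have h6 := Int.emod_lt_of_pos (c' * v) hb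
  set r := -(c * v) % b
  set r' := c' * v % b
  obtain rfl : c' = c + k := by
    -- Multiplying by `2 * b` clears the floors; `R` collects their remainders.
    refine eq_add_of_quadratic_step (R := 2 * k * (b - r - r')) (by positivity : 0 < b * d)
      (by omega) ?_ hc hc' ?_
    · rw [abs_mul, abs_of_pos (by omega : 0 < 2 * k)]
      exact mul_le_mul_of_nonneg_left (abs_le.mpr ⟨by omega, by omega⟩) (by omega)
    · have e1 := h.two_mul_q c
      have e2 := h.two_mul_q c'
      linear_combination 2 * b * heq - b * e2 + b * e1 + 2 * k * h4 + 2 * k * h1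
  exact heq

/-- Shifting `c` by a multiple of `b` changes the two floors by opposite integers, so the identity
passes from large `c` to all `c`. -/
theorem half_sum_add_floor (h : RowPacking b d v k e γ q) (c : ℤ) :
    d * k + e = 2 * (1 + -(c * v) / b + (c + k) * v / b) := by
  have hb := h.b_pos
  have hk := h.k_ge
  obtain ⟨j, hj⟩ : ∃ j, 2 * k * b + (k + 1) * |b * e - 2 * k * v| + b * d * k ^ 2 < c + b * j := by
    set C := 2 * k * b + (k + 1) * |b * e - 2 * k * v| + b * d * k ^ 2
    refine ⟨|C - c| + 1, ?_⟩
    nlinarith [le_abs_self (C - c), abs_nonneg (C - c)]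
  have h1 := h.row_start_add_of_large hj
  have e1 : -((c + b * j) * v) / b = -(c * v) / b - j * v := by
    rw [show -((c + b * j) * v) = -(c * v) + b * (-(j * v)) by ring,
      Int.add_mul_ediv_left _ _ hb.ne']
    ring
  have e2 : (c + b * j + k) * v / b = (c + k) * v / b + j * v := by
    rw [show (c + b * j + k) * v = (c + k) * v + b * (j * v) by ring,
      Int.add_mul_ediv_left _ _ hb.ne']
  rw [e1, e2] at h1
  have e3 := h.two_mul_q (c + b * j)
  have e4 := h.two_mul_q (c + b * j + k)
  refine mul_left_cancel₀ (by omega : k ≠ 0) ?_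
  linear_combination 2 * h1 - e4 + e3

theorem row_start_add (h : RowPacking b d v k e γ q) (c : ℤ) :
    q (c + k) - k * ((c + k) * v / b) = q c + k * (c * d + -(c * v) / b + 1) := by
  have h1 := h.half_sum_add_floor c
  have e3 := h.two_mul_q c
  have e4 := h.two_mul_q (c + k)
  refine mul_left_cancel₀ (two_ne_zero : (2 : ℤ) ≠ 0) ?_
  linear_combination e4 - e3 + k * h1

theorem q_zero (h : RowPacking b d v k e γ q) : q 0 = γ := by
  have := h.two_mul_q 0
  simp at this
  exact this

/-- Row 0 is the apex alone, of value `γ`. A point of value `γ - k` would be followed, in its row or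
at the start of row `c + k`, by a point of value `γ` other than the apex. -/
theorem const_lt (h : RowPacking b d v k e γ q) : γ < k := by
  by_contra! hγ
  have hb := h.b_pos
  have hd := h.d_pos
  have hk := h.k_ge
  have h0 := h.q_zero
  obtain ⟨c, t, h1, h2, h3⟩ := h.surj (γ - k) (by omega)
  have hc0 : 0 ≤ c := by
    have : 0 ≤ c * (d * b) := by nlinarith
    exact nonneg_of_mul_nonneg_left this (by positivity)
  have key : ∀ s, 0 ≤ (c + k) * v + s * b → (c + k) * v + s * b ≤ (c + k) * d * b →
      q (c + k) + k * s ≠ γ := by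
    intro s hs1 hs2 hs
    have := (h.inj (c + k) s 0 0 hs1 hs2 (by simp) (by simp) (by rw [hs, h0]; ring)).1
    omega
  rcases le_or_gt (c * v + (t + 1) * b) (c * d * b) with hle | hgt
  · obtain ⟨rfl, h5⟩ := h.inj c (t + 1) 0 0 (by nlinarith) hle (by simp) (by simp)
      (by rw [h0]; linarith)
    obtain rfl : t = -1 := by omega
    nlinarith
  · have g1 := Int.mul_ediv_add_emod (-(c * v)) b
    have g2 := Int.emod_nonneg (-(c * v)) hb.ne'
    have g3 := Int.emod_lt_of_pos (-(c * v)) hb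
    have ht : t = c * d + -(c * v) / b := by
      have h7 : 0 < b * (t - (c * d + -(c * v) / b) + 1) := by nlinarith
      have h8 : b * (t - (c * d + -(c * v) / b) - 1) < 0 := by nlinarith
      have h9 := pos_of_mul_pos_right h7 hb.le
      have h10 := neg_of_mul_neg_right h8 hb.le
      omega
    have g4 := Int.mul_ediv_add_emod ((c + k) * v) b
    have g5 := Int.emod_nonneg ((c + k) * v) hb.ne'
    have g6 := Int.emod_lt_of_pos ((c + k) * v) hb
    have hcd : b ≤ (c + k) * d * b := by nlinarith [mul_pos (by omega : 0 < c + k) hd]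
    refine key (-((c + k) * v / b)) (by nlinarith) (by nlinarith) ?_
    have := h.row_start_add c
    rw [← ht] at this
    linarith

theorem row_start_lt_succ (h : RowPacking b d v k e γ q) {c : ℤ}
    (hc : 2 * k * b + |b * e - 2 * k * v| < c) :
    q c - k * (c * v / b) < q (c + 1) - k * ((c + 1) * v / b) := by
  have hb := h.b_pos
  have hd := h.d_pos
  have hk := h.k_ge
  have h1 := Int.mul_ediv_add_emod (c * v) b
  have h2 := Int.emod_nonneg (c * v) hb.ne'
  have h3 := Int.emod_lt_of_pos (c * v) hb
  have h4 := Int.mul_ediv_add_emod ((c + 1) * v) b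
  have h5 := Int.emod_nonneg ((c + 1) * v) hb.ne'
  have h6 := Int.emod_lt_of_pos ((c + 1) * v) hb
  set r := c * v % b
  set r' := (c + 1) * v % b
  have e1 := h.two_mul_q c
  have e2 := h.two_mul_q (c + 1)
  have hE := neg_abs_le (b * e - 2 * k * v)
  have hE0 := abs_nonneg (b * e - 2 * k * v)
  set A := |b * e - 2 * k * v|
  have key : 2 * b * ((q (c + 1) - k * ((c + 1) * v / b)) - (q c - k * (c * v / b)))
      = b * d * (2 * c + 1) + (b * e - 2 * k * v) + 2 * k * (r' - r) := by
    linear_combination b * e2 - b * e1 - 2 * k * h4 + 2 * k * h1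
  have hkb : 0 < k * b := by positivity
  have hkr : k * r ≤ k * b := by nlinarith
  have hkr' : 0 ≤ k * r' := by positivity
  have hbd : 0 < b * d := by positivity
  have hbdc : c ≤ b * d * c := by nlinarith
  have hpos : 0 < 2 * b *
      ((q (c + 1) - k * ((c + 1) * v / b)) - (q c - k * (c * v / b))) := by
    rw [key]; nlinarith
  have := pos_of_mul_pos_right hpos (by omega)
  omega

theorem row_start_lt (h : RowPacking b d v k e γ q) {c : ℤ}
    (hc : 2 * k * b + |b * e - 2 * k * v| < c) {c' : ℤ} (hcc' : c < c') :
    q c - k * (c * v / b) < q c' - k * (c' * v / b) := by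
  induction c', hcc' using Int.leInduction with
  | base => exact h.row_start_lt_succ hc
  | succ x hx ih => exact ih.trans (h.row_start_lt_succ (hc.trans hx))

/-- Shifting by a multiple of `k` keeps the congruence and reaches rows with increasing starts.
There row `x + g` starts between the start of row `x` and the value following its end, so a
congruence would repeat a value of row `x`. -/
theorem not_dvd_sub_add (h : RowPacking b d v k e γ q) (c : ℤ) {g : ℤ} (hg : 0 < g) (hgk : g < k) :
    ¬ k ∣ q (c + g) - q c := by
  rintro ⟨s₀, hs₀⟩
  have hb := h.b_pos
  have hd := h.d_pos
  have hk := h.k_ge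
  obtain ⟨j, hj⟩ : ∃ j, 2 * k * b + |b * e - 2 * k * v| < c + 2 * k * j := by
    set C := 2 * k * b + |b * e - 2 * k * v|
    refine ⟨|C - c| + 1, ?_⟩
    nlinarith [le_abs_self (C - c), abs_nonneg (C - c)]
  obtain ⟨x, hx⟩ : ∃ x, x = c + 2 * k * j := ⟨_, rfl⟩
  obtain ⟨s, hs⟩ : ∃ s, q (x + g) - q x = k * s := by
    refine ⟨s₀ + 2 * d * g * j, ?_⟩
    refine mul_left_cancel₀ (two_ne_zero : (2 : ℤ) ≠ 0) ?_
    subst hx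
    linear_combination h.two_mul_q (c + 2 * k * j + g) - h.two_mul_q (c + 2 * k * j)
      - h.two_mul_q (c + g) + h.two_mul_q c + 2 * hs₀
  rw [← hx] at hj
  have hx0 : 0 < x := by
    have := abs_nonneg (b * e - 2 * k * v)
    have : 0 < k * b := by positivity
    linarith
  have m1 := h.row_start_lt hj (by omega : x < x + g)
  have m2 := h.row_start_lt (by omega : 2 * k * b + |b * e - 2 * k * v| < x + g)
    (by omega : x + g < x + k)
  rw [h.row_start_add] at m2
  have g1 := Int.mul_ediv_add_emod (-(x * v)) b
  have g2 := Int.emod_nonneg (-(x * v)) hb.ne'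
  have g4 := Int.mul_ediv_add_emod ((x + g) * v) b
  have g5 := Int.emod_nonneg ((x + g) * v) hb.ne'
  have g6 := Int.emod_lt_of_pos ((x + g) * v) hb
  have i1 := Int.mul_ediv_add_emod (x * v) b
  have i2 := Int.emod_nonneg (x * v) hb.ne'
  have i3 := Int.emod_lt_of_pos (x * v) hb
  set F := (x + g) * v / b
  set G := x * v / b
  set H := -(x * v) / b
  have l1 : 0 < k * (s - F + G) := by linarith
  have l2 : 0 < k * (x * d + H + 1 - s + F) := by linarith
  have l3 := pos_of_mul_pos_right l1 (by omega)
  have l4 := pos_of_mul_pos_right l2 (by omega)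
  have hcd : b ≤ (x + g) * d * b := by nlinarith [mul_pos (by omega : 0 < x + g) hd]
  have n1 : 0 ≤ b * (s - F + G - 1) := mul_nonneg hb.le (by omega)
  have n2 : 0 ≤ b * (x * d + H - s + F) := mul_nonneg hb.le (by omega)
  have := (h.inj (x + g) (-F) x (s - F) (by nlinarith) (by nlinarith) (by nlinarith)
    (by nlinarith) (by linear_combination hs)).1
  omega

/-! ### Bounds on d and k -/

/-- For `d ≤ 2` the axis of the parabola is an integer or half-integer, so `q` agrees at two
integers at distance 1 or 2, less than `k`. -/
theorem three_le (h : RowPacking b d v k e γ q) : 3 ≤ d := by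
  have hd := h.d_pos
  have hk := h.k_ge
  have h1 := h.two_mul_q 1
  by_contra! hlt
  obtain rfl | rfl : d = 1 ∨ d = 2 := by omega
  · obtain ⟨c, rfl⟩ : ∃ c, e = -(2 * c + 1) := ⟨-(e + 1) / 2, by omega⟩
    refine h.not_dvd_sub_add c (g := 1) (by omega) (by omega) ?_
    have : q (c + 1) - q c = 0 := by
      linarith [h.two_mul_q c, h.two_mul_q (c + 1)]
    rw [this]
    exact dvd_zero k
  · obtain ⟨f, rfl⟩ : ∃ f, e = 2 * f := ⟨e / 2, by omega⟩
    obtain ⟨c, g, hg, hg', hf⟩ : ∃ c g : ℤ, 0 < g ∧ g < k ∧ f = -(2 * c + g) := by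
      rcases Int.even_or_odd' f with ⟨j, hj | hj⟩
      · exact ⟨-j - 1, 2, by omega, by omega, by omega⟩
      · exact ⟨-j - 1, 1, by omega, by omega, by omega⟩
    refine h.not_dvd_sub_add c hg hg' ?_
    have : q (c + g) - q c = 0 := by
      subst hf
      linarith [h.two_mul_q c, h.two_mul_q (c + g)]
    rw [this]
    exact dvd_zero k

theorem false (h : RowPacking b d v k e γ q) : False := by
  have hb := h.b_pos
  have hd := h.three_le
  have hk := h.k_ge
  have hγ := h.const_lt
  have hK := h.half_sum_add_floor 0
  simp only [zero_mul, neg_zero, Int.zero_ediv, add_zero, zero_add] at hK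
  have q1 := h.two_mul_q 1
  have q2 := h.two_mul_q 2
  have a1 := Int.mul_ediv_add_emod (k * v) b
  have a2 := Int.emod_nonneg (k * v) hb.ne'
  have g1 := Int.mul_ediv_add_emod (2 * v) b
  have g2 := Int.emod_nonneg (2 * v) hb.ne'
  have g3 := Int.emod_lt_of_pos (2 * v) hb
  have hnn := h.nonneg 2 (-(2 * v / b)) (by nlinarith) (by nlinarith)
  set P := k * v / b
  set Q := 2 * v / b
  have hsize : 2 * P - k * Q < k := by
    have : 0 < b * (k - (2 * P - k * Q)) := by
      have : b * (k - (2 * P - k * Q)) = k * (b - 2 * v % b) + 2 * (k * v % b) := by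
        linear_combination (-2) * a1 + k * g1
      rw [this]
      have := mul_pos (by omega : 0 < k) (by omega : 0 < b - 2 * v % b)
      omega
    have := pos_of_mul_pos_right this hb.le
    omega
  -- This is the value at the start of row 2, with `e` eliminated by `hK`.
  have hval : 0 ≤ γ - d * (k - 2) + (2 * P - k * Q) + 2 := by linarith
  have hk6 : k ≤ 6 := by nlinarith
  -- For even `k`, `hK` makes `e` even, so `q1` makes `d` even. This excludes `k = 6`, where `d =
  -- 3`; for `k = 4` it leaves `d = 4`, and `2 * P - 4 * Q ≤ 2` contradicts `hval`.
  obtain rfl | rfl | rfl : k = 4 ∨ k = 5 ∨ k = 6 := by omega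
  · omega
  · obtain rfl : d = 3 := by omega
    -- At `c = -3 - e` the doubled difference `6 * c + 3 + e` equals `5 * c`.
    refine h.not_dvd_sub_add (-3 - e) (g := 1) (by omega) (by omega) ?_
    have s1 := h.two_mul_q (-3 - e)
    have s2 := h.two_mul_q (-3 - e + 1)
    have : 2 * (q (-3 - e + 1) - q (-3 - e)) = 5 * (-3 - e) := by linarith
    omega
  · omega

end RowPacking

/-- A bijection from the lattice points of a cone onto the nonnegative integers cannot be quadratic
in the number of the row and affine with step `± k` along each row if `k ≥ 4`. -/
theorem no_row_packing {b d v k e γ δ : ℤ} {q : ℤ → ℤ} (hb : 0 < b) (hd : 0 < d) (hk : 4 ≤ k)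
    (hδ : δ = k ∨ δ = -k) (hq : ∀ c, 2 * q c = d * c ^ 2 + e * c + 2 * γ)
    (hnn : ∀ c t, 0 ≤ c * v + t * b → c * v + t * b ≤ c * d * b → 0 ≤ q c + δ * t)
    (hinj : ∀ c t c' t', 0 ≤ c * v + t * b → c * v + t * b ≤ c * d * b →
      0 ≤ c' * v + t' * b → c' * v + t' * b ≤ c' * d * b →
      q c + δ * t = q c' + δ * t' → c = c' ∧ t = t')
    (hsurj : ∀ z, 0 ≤ z →
      ∃ c t, 0 ≤ c * v + t * b ∧ c * v + t * b ≤ c * d * b ∧ q c + δ * t = z) : False := by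
  rcases hδ with rfl | rfl
  · exact RowPacking.false ⟨hb, hd, hk, hq, hnn, hinj, hsurj⟩
  -- The reflection `t ↦ c * d - t` swaps the sides of the cone and reverses each row.
  · refine RowPacking.false (b := b) (d := d) (v := -v) (k := k) (e := e - 2 * k * d) (γ := γ)
      (q := fun c => q c - k * (c * d)) ⟨hb, hd, hk, ?_, ?_, ?_, ?_⟩
    · intro c
      linear_combination hq c
    · intro c t h1 h2
      linarith [hnn c (c * d - t) (by linarith) (by linarith)]
    · intro c t c' t' h1 h2 h3 h4 h5
      obtain ⟨rfl, h6⟩ := hinj c (c * d - t) c' (c' * d - t') (by linarith) (by linarith)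
        (by linarith) (by linarith) (by linarith)
      exact ⟨rfl, by linarith⟩
    · intro z hz
      obtain ⟨c, t, h1, h2, h3⟩ := hsurj z hz
      exact ⟨c, c * d - t, by linarith, by linarith, by linarith⟩

/-! ### From staircases to rows -/

theorem eval_of_isHomogeneous_one {φ : MvPolynomial (Fin 2) ℝ} (hφ : φ.IsHomogeneous 1) :
    ∃ e₁ e₂ : ℝ, ∀ x y : ℝ, MvPolynomial.eval ![x, y] φ = e₁ * x + e₂ * y := by
  refine ⟨∑ i ∈ φ.support, φ.coeff i * i 0, ∑ i ∈ φ.support, φ.coeff i * i 1, fun x y => ?_⟩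
  rw [MvPolynomial.eval_eq', Finset.sum_mul, Finset.sum_mul, ← Finset.sum_add_distrib]
  refine Finset.sum_congr rfl fun i hi => ?_
  have h1 : i 0 + i 1 = 1 := by
    have := hφ (MvPolynomial.mem_support_iff.mp hi)
    rw [Finsupp.weight_apply, Finsupp.sum_fintype _ _ (by simp), Fin.sum_univ_two] at this
    simpa using this
  rw [Fin.prod_univ_two]
  obtain ⟨h2, h3⟩ | ⟨h2, h3⟩ : (i 0 = 0 ∧ i 1 = 1) ∨ (i 0 = 1 ∧ i 1 = 0) := by omega
  all_goals simp [h2, h3]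

theorem exists_evalAt_eq {p φ : MvPolynomial (Fin 2) ℝ} (hp : p.totalDegree = 2)
    (hφ : MvPolynomial.homogeneousComponent 2 p = φ) :
    ∃ e₁ e₂ γ : ℝ, ∀ z : ℝ × ℝ,
      evalAt p z = MvPolynomial.eval ![z.1, z.2] φ + e₁ * z.1 + e₂ * z.2 + γ := by
  obtain ⟨e₁, e₂, h⟩ := eval_of_isHomogeneous_one
    (MvPolynomial.homogeneousComponent_isHomogeneous 1 p)
  refine ⟨e₁, e₂, p.coeff 0, fun z => ?_⟩
  have hs := MvPolynomial.sum_homogeneousComponent p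
  rw [hp, Finset.sum_range_succ, Finset.sum_range_succ, Finset.sum_range_one, hφ,
    MvPolynomial.homogeneousComponent_zero] at hs
  conv_lhs => rw [evalAt, ← hs]
  rw [map_add, map_add, h, MvPolynomial.eval_C]
  ring

theorem mem_sectorLattice_iff {n m : ℕ} (hn : 0 < n) (hm : 0 < m) {z : ℤ × ℤ} :
    z ∈ sectorLattice ((n : ℝ) / m) ↔ 0 ≤ z.2 ∧ (m : ℤ) * z.2 ≤ n * z.1 := by
  have hm' : (0 : ℝ) < m := by exact_mod_cast hm
  have key : (z.2 : ℝ) ≤ (n : ℝ) / m * z.1 ↔ (m : ℤ) * z.2 ≤ n * z.1 := by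
    rw [div_mul_eq_mul_div, le_div_iff₀ hm', mul_comm]
    exact_mod_cast Iff.rfl
  simp only [sectorLattice, sector, toPlane, Set.mem_ofPred_eq, key, Int.cast_nonneg_iff]
  refine ⟨fun h => h.2, fun h => ⟨?_, h⟩⟩
  have : 0 ≤ (n : ℤ) * z.1 := le_trans (mul_nonneg (by positivity) h.1) h.2
  exact nonneg_of_mul_nonneg_right this (by exact_mod_cast hn)

theorem mem_stairs_iff {n m c : ℕ} (hn : 0 < n) (hm : 0 < m) {z : ℤ × ℤ} :
    z ∈ stairs n m c ↔ (0 ≤ z.2 ∧ (m : ℤ) * z.2 ≤ n * z.1) ∧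
      ((m : ℤ) - 1) * z.2 = n * z.1 - c * stairGcd n m := by
  rw [← mem_sectorLattice_iff hn hm]
  refine and_congr Iff.rfl ?_
  simp only [toPlane]
  exact_mod_cast Iff.rfl

theorem exists_stairGcd_factors {n m : ℕ} (hn : 0 < n) :
    ∃ a b u v : ℤ, 0 < stairGcd n m ∧ 0 < b ∧ (n : ℤ) = b * stairGcd n m ∧
      (m : ℤ) - 1 = a * stairGcd n m ∧ b * u - a * v = 1 := by
  have hl : 0 < stairGcd n m := Int.gcd_pos_of_ne_zero_left _ (by exact_mod_cast hn.ne')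
  obtain ⟨b, a, hab, hb, ha⟩ := Int.exists_gcd_one hl
  obtain ⟨u, v, huv⟩ := Int.isCoprime_iff_gcd_eq_one.mpr hab
  refine ⟨a, b, u, -v, hl, ?_, hb, ha, by linarith⟩
  have : (0 : ℤ) < b * stairGcd n m := hb ▸ (by exact_mod_cast hn)
  exact pos_of_mul_pos_left this (by positivity)

theorem consecutiveStairs_one_zero {n m : ℕ} (hn : 0 < n) (hm : 0 < m) {a b u v : ℤ}
    (hb : 0 < b) (hnb : (n : ℤ) = b * stairGcd n m) (hma : (m : ℤ) - 1 = a * stairGcd n m)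
    (huv : b * u - a * v = 1) : ConsecutiveStairs n m (1 + a, b) (1, 0) := by
  lift b to ℕ using hb.le
  have hl : (0 : ℤ) < stairGcd n m := by
    exact pos_of_mul_pos_right (hnb ▸ (by exact_mod_cast hn)) hb.le
  have hm0 : (0 : ℤ) < m := by exact_mod_cast hm
  refine ⟨fun h => hb.ne' (congrArg Prod.snd h), b, ?_, ?_, ?_⟩
  · rw [mem_stairs_iff hn hm]
    refine ⟨⟨hb.le, ?_⟩, ?_⟩
    · have h1 : (m : ℤ) ≤ stairGcd n m * (1 + a) := by nlinarith
      have := mul_le_mul_of_nonneg_left h1 hb.le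
      rw [hnb]
      linarith
    · rw [hma, hnb]; ring
  · rw [mem_stairs_iff hn hm]
    refine ⟨⟨le_rfl, by simp⟩, ?_⟩
    rw [hnb]; ring
  · rintro ⟨x, y⟩ - hxy
    rw [segment_eq_image'] at hxy
    obtain ⟨θ, ⟨hθ0, hθ1⟩, hθ⟩ := hxy
    simp only [toPlane, Prod.mk_sub_mk, Prod.smul_mk, Prod.mk_add_mk, Prod.mk.injEq, smul_eq_mul]
      at hθ
    obtain ⟨hx, hy⟩ := hθ
    push_cast at hx hy
    have huv' : (b : ℝ) * u - a * v = 1 := by exact_mod_cast huv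
    -- The segment parameter is a determinant of integer vectors, so it is an integer in [0, 1].
    have hs : 1 - θ = ((y * u - (x - 1) * v : ℤ) : ℝ) := by
      push_cast
      linear_combination (θ - 1) * huv' + u * hy - v * hx
    obtain ⟨s, hs'⟩ : ∃ s : ℤ, s = y * u - (x - 1) * v := ⟨_, rfl⟩
    rw [← hs'] at hs
    have hs0 : 0 ≤ s := by exact_mod_cast (by linarith : (0 : ℝ) ≤ s)
    have hs1 : s ≤ 1 := by exact_mod_cast (by linarith : (s : ℝ) ≤ 1)
    have ex : x = 1 + s * a := by
      have : (x : ℝ) = 1 + s * a := by rw [← hs]; linear_combination -hx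
      exact_mod_cast this
    have ey : y = s * b := by
      have : (y : ℝ) = s * b := by rw [← hs]; linear_combination -hy
      exact_mod_cast this
    obtain rfl | rfl : s = 0 ∨ s = 1 := by omega
    · right; simp [ex, ey]
    · left; simp [ex, ey]

theorem mainTheorem2 (n m : ℕ) (hn : 0 < n) (hm : 0 < m) (hnm : Nat.Coprime n m)
    (k : ℕ) (hk : 4 ≤ k) (p : MvPolynomial (Fin 2) ℝ)
    (hp : IsQuadraticPackingPolynomial ((n : ℝ) / (m : ℝ)) p) :
    ¬ IsKStairPolynomial n m k p := by
  rintro ⟨hdeg, hquad, hint, hstep⟩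
  obtain ⟨-, hmaps, hinj, hsurj⟩ := hp
  obtain ⟨a, b, u, v, hl, hb, hnb, hma, huv⟩ := exists_stairGcd_factors (m := m) hn
  have hcons := hstep _ _ (consecutiveStairs_one_zero hn hm hb hnb hma huv)
  set l := stairGcd n m
  obtain ⟨e₁, e₂, γ, hform⟩ := exists_evalAt_eq hdeg hquad
  have hl' : (0 : ℝ) < l := by exact_mod_cast hl
  have hb' : (0 : ℝ) < b := by exact_mod_cast hb
  have hn' : (n : ℝ) = b * l := by exact_mod_cast hnb
  have hm' : (m : ℝ) - 1 = a * l := by exact_mod_cast hma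
  have huv' : (b : ℝ) * u - a * v = 1 := by exact_mod_cast huv
  have hP : ∀ x y : ℤ, evalAt p (toPlane (x, y))
      = l / b / 2 * (b * x - a * y) ^ 2 + e₁ * x + e₂ * y + γ := by
    intro x y
    rw [hform]
    simp only [toPlane, map_mul, map_pow, map_sub, MvPolynomial.eval_C, MvPolynomial.eval_X,
      Matrix.cons_val_zero, Matrix.cons_val_one, hn', hm']
    field_simp
  have hrow : ∀ c t : ℤ, evalAt p (toPlane (c * u + t * a, c * v + t * b))
      = l / b / 2 * c ^ 2 + (e₁ * u + e₂ * v) * c + (e₁ * a + e₂ * b) * t + γ := by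
    intro c t
    have : (b : ℝ) * (c * u + t * a) - a * (c * v + t * b) = c := by
      linear_combination c * huv'
    rw [hP]
    push_cast
    rw [this]
    ring
  obtain ⟨δ, hδ, hδk⟩ : ∃ δ : ℤ, (e₁ * a + e₂ * b : ℝ) = δ ∧ (δ = k ∨ δ = -k) := by
    rw [hP, hP] at hcons
    push_cast at hcons
    rcases hcons with h | h
    · exact ⟨k, by push_cast; rw [← h]; ring, Or.inl rfl⟩
    · exact ⟨-k, by push_cast; rw [← h]; ring, Or.inr rfl⟩
  choose q hq using fun c : ℤ => hint (c * u + 0 * a, c * v + 0 * b)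
  have hq' : ∀ c : ℤ, (q c : ℝ) = l / b / 2 * c ^ 2 + (e₁ * u + e₂ * v) * c + γ := by
    intro c
    rw [← hq, hrow]
    push_cast
    ring
  have hF : ∀ c t : ℤ, evalAt p (toPlane (c * u + t * a, c * v + t * b))
      = ((q c + δ * t : ℤ) : ℝ) := by
    intro c t
    push_cast
    rw [hrow, hq', ← hδ]
    ring
  have q0 := hq' 0
  have q1 := hq' 1
  have q2 := hq' (-1)
  push_cast at q0 q1 q2
  -- A second difference of the integer-valued `q`; hence `b` divides `l`.
  have hd : (l : ℝ) / b = (q 1 + q (-1) - 2 * q 0 : ℤ) := by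
    push_cast; linarith
  obtain ⟨d, hd'⟩ : ∃ d, d = q 1 + q (-1) - 2 * q 0 := ⟨_, rfl⟩
  rw [← hd'] at hd
  have hdpos : 0 < d := by
    have : (0 : ℝ) < d := hd ▸ div_pos hl' hb'
    exact_mod_cast this
  have hld : (l : ℤ) = d * b := by
    have : (l : ℝ) = d * b := by rw [← hd]; field_simp
    exact_mod_cast this
  have hmem : ∀ c t : ℤ, (c * u + t * a, c * v + t * b) ∈ sectorLattice ((n : ℝ) / m) ↔
      0 ≤ c * v + t * b ∧ c * v + t * b ≤ c * d * b := by
    intro c t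
    rw [mem_sectorLattice_iff hn hm]
    have : (n : ℤ) * (c * u + t * a) - m * (c * v + t * b) = c * d * b - (c * v + t * b) := by
      linear_combination (c * u + t * a) * hnb - (c * v + t * b) * hma + c * l * huv + c * hld
    refine and_congr Iff.rfl ?_
    constructor <;> intro h <;> linarith
  refine no_row_packing (b := b) (d := d) (v := v) (k := k) (e := q 1 - q (-1)) (γ := q 0)
    (δ := δ) (q := q) hb hdpos (by exact_mod_cast hk) hδk ?_ ?_ ?_ ?_
  · intro c
    have : (2 * q c : ℝ) = d * c ^ 2 + (q 1 - q (-1)) * c + 2 * q 0 := by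
      rw [hq' c, ← hd, q0, q1, q2]
      ring
    exact_mod_cast this
  · intro c t h1 h2
    obtain ⟨N, hN⟩ := hmaps ((hmem c t).mpr ⟨h1, h2⟩)
    simp only [hF] at hN
    have : (N : ℤ) = q c + δ * t := by exact_mod_cast hN
    omega
  · intro c t c' t' h1 h2 h3 h4 h5
    have := hinj ((hmem c t).mpr ⟨h1, h2⟩) ((hmem c' t').mpr ⟨h3, h4⟩) (by simp only [hF, h5])
    obtain ⟨hx, hy⟩ := Prod.mk.inj this
    obtain rfl : c = c' := by
      linear_combination b * hx - a * hy - (c - c') * huv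
    refine ⟨rfl, ?_⟩
    linear_combination u * hy - v * hx - (t - t') * huv
  · intro z hz
    obtain ⟨⟨x, y⟩, hxy, hval⟩ := hsurj ⟨z.toNat, rfl⟩
    have ex : x = (b * x - a * y) * u + (u * y - v * x) * a := by
      linear_combination -x * huv
    have ey : y = (b * x - a * y) * v + (u * y - v * x) * b := by
      linear_combination -y * huv
    generalize b * x - a * y = c at ex ey
    generalize u * y - v * x = t at ex ey
    subst ex ey
    obtain ⟨h1, h2⟩ := (hmem c t).mp hxy
    simp only [hF] at hval
    have hval' : q c + δ * t = (z.toNat : ℤ) := by exact_mod_cast hval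
    exact ⟨c, t, h1, h2, by omega⟩
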